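/- Let $\mathbb{F}_q$ be a finite field, let $0\le v<j<s$ be integers, and let $S_1,S_2\subseteq\mathbb{F}_q$ with $\#S_1=\#S_2=s$. Let $\mathrm{ev}$ evaluate polynomials in $\mathbb{F}_q[X_1,X_2]$ at the points of $S_1\times S_2$, and for a set $L$ of monomials let $C(L)\subseteq\mathbb{F}_q^{S_1\times S_2}$ be the span of $\{\mathrm{ev}(M): M\in L\}$. Put $$L_1=\{X_1^{a}X_2^{b}: 0\le a,b\le j\},\quad \Box=\{X_1^{a}X_2^{b}: v\le a,b\le j\},\quad L_2=L_1\setminus\Box,$$ $C_1=C(L_1)$, $C_2=C(L_2)$, and $\Diamond=\{M\in L_1: X_1^vX_2^v\preceq M\}$, where $\preceq$ is the lexicographic ordering with $X_2\prec X_1$. For a set $K$ of monomials let $D(K)$ be the number of monomials $X_1^aX_2^b$ with $0\le a,b<s$ that are divisible by some element of $K$. Assume that the scheme is considerate: for every $i=1,\dots,\#\Box$, the minimum of $D(K)$ over all $K\subseteq\Diamond$ with $\#K=i$ is attained by some $K'\subseteq\Box$. Consider the linear ramp secret sharing scheme defined from $C_2\subseteq C_1$: extend a basis $b_1,\dots,b_{k}$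 of $C_2$ to a basis $b_1,\dots,b_{k+\ell}$ of $C_1$; a secret $\sigma\in\mathbb{F}_q^\ell$ is encoded as $c=\sum_{i\le k}a_ib_i+\sum_{i\le\ell}\sigma_ib_{k+i}$ with random $a\in\mathbb F_q^k$, and the participant $\alpha\in S_1\times S_2$ receives $c_\alpha$. A set $A$ of participants obtains $\ell-\dim V$ $q$-bits of information if the secrets in accordance with its shares form an affine space $p+V\subseteq\mathbb{F}_q^\ell$. Let $r_m$ be the smallest $r$ such that every set of $r$ participants can recover (at least) $m$ $q$-bits of information. Call $A$ non-$m$-qualifying if it cannot recover $m$ $q$-bits, and maximum non-$m$-qualifying if it has the largest size among the non-$m$-qualifying sets. Let $M_e(C_1,C_2)$ be the minimum of $\#\mathrm{Supp}(E)$ over all linear $E\subseteq C_1$ with $E\cap C_2=\{0\}$ and $\dim E=e$, where $\mathrm{Supp}(E)$ is the set of positions in which some word of $E$ is nonzero. Then there are $n=s^2$ participants and the secret has size $\ell=(j-v+1)^2$. Every integer $e$ with $1\le e\le\ell$ can be written in exactly one of the following two ways, with unique integers $z,h$: $$\text{(1)}\quad e=z(z-1)-h,\qquad 2\le z\le\sqrt{\ell},\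 0\le h<z-1;$$ $$\text{(2)}\quad e=z^2-h,\qquad 1\le z\le\sqrt{\ell},\ 0\le h\le z-1.$$ In situation (1), $$M_e(C_1,C_2)=(s-j-1+z)(s-j-2+z)-h,\qquad r_{\ell-e+1}=s^2-(s-j-1+z)(s-j-2+z)+h+1 .$$ In situation (2), $$M_e(C_1,C_2)=(s-j-1+z)^2-h,\qquad r_{\ell-e+1}=s^2-(s-j-1+z)^2+h+1 .$$ Moreover, let $T_1\subseteq S_1$ and $T_2\subseteq S_2$, where $(\#T_1,\#T_2)$ is $(s-j-1+z,\,s-j-2+z)$ or $(s-j-2+z,\,s-j-1+z)$ in situation (1), and $(s-j-1+z,\,s-j-1+z)$ in situation (2), and let $U\subseteq T_1\times T_2$ with $\#U\le h$. Then the set of participants $A=(S_1\times S_2)\setminus\big((T_1\times T_2)\setminus U\big)$ obtains at most $\ell-e$ $q$-bits of information, and $A$ is maximum non-$(\ell-e+1)$-qualifying if and only if $\#U=h$. -/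

import Mathlib

/-!
# Linear ramp secret sharing from nested codes, and monomial-Cartesian schemes
-/

section Scheme

variable {F ι : Type*} [Field F]

/-- The size of the support of a linear code `D ⊆ F^ι`: the number of positions in which at least
one word of `D` is nonzero. -/
noncomputable def supportSize (D : Submodule F (ι → F)) : ℕ :=
  {i : ι | ∃ c ∈ D, c i ≠ 0}.ncard

/-- The `t`-th relative generalized Hamming weight `M_t(C₁, C₂)` of nested codes `C₂ ⊆ C₁`. -/
noncomputable def relGenHammingWeight (C₁ C₂ : Submodule F (ι → F)) (t : ℕ) : ℕ :=
  sInf {w : ℕ | ∃ D : Submodule F (ι → F),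
    D ≤ C₁ ∧ D ⊓ C₂ = ⊥ ∧ Module.finrank F D = t ∧ supportSize D = w}

/-- The coset construction of a linear ramp secret sharing scheme with participants `ι` and secrets
in `F^ℓ` from nested codes `C₂ ⊆ C₁ ⊆ F^ι`: a basis `mask` of `C₂` that is extended by `payload` to
a basis of `C₁`. -/
structure CosetScheme (C₂ C₁ : Submodule F (ι → F)) (k ℓ : ℕ) where
  mask : Fin k → ι → F
  payload : Fin ℓ → ι → F
  linearIndependent : LinearIndependent F (Sum.elim mask payload)
  span_mask : Submodule.span F (Set.range mask) = C₂
  span_mask_payload : Submodule.span F (Set.range (Sum.elim mask payload)) = C₁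

namespace CosetScheme

variable {C₂ C₁ : Submodule F (ι → F)} {k ℓ : ℕ}

/-- The vector of shares dealt for the secret `σ` when the random coefficients are `a`;
participant `i` receives the `i`-th entry. -/
def encode (scheme : CosetScheme C₂ C₁ k ℓ) (a : Fin k → F) (σ : Fin ℓ → F) : ι → F :=
  (∑ t, a t • scheme.mask t) + ∑ t, σ t • scheme.payload t

/-- The secrets that are in accordance with the shares that the participants in `A` hold when the
share vector `c` has been dealt. -/
def possibleSecrets (scheme : CosetScheme C₂ C₁ k ℓ) (A : Set ι) (c : ι → F) : Set (Fin ℓ → F) :=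
  {σ | ∃ a : Fin k → F, ∀ i ∈ A, scheme.encode a σ i = c i}

/-- The number `ℓ - dim V` of `q`-bits of information that the participants in `A` hold about the
secret when the share vector `c` has been dealt, where the set of possible secrets is the affine
space `p + V`. -/
noncomputable def information (scheme : CosetScheme C₂ C₁ k ℓ) (A : Set ι) (c : ι → F) : ℕ :=
  ℓ - Module.finrank F (vectorSpan F (scheme.possibleSecrets A c))

/-- `A` can recover `m` `q`-bits of information, whatever has been dealt. -/
def CanRecover (scheme : CosetScheme C₂ C₁ k ℓ) (A : Set ι) (m : ℕ) : Prop :=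
  ∀ a σ, m ≤ scheme.information A (scheme.encode a σ)

/-- `A` obtains at most `m` `q`-bits of information, whatever has been dealt. -/
def ObtainsAtMost (scheme : CosetScheme C₂ C₁ k ℓ) (A : Set ι) (m : ℕ) : Prop :=
  ∀ a σ, scheme.information A (scheme.encode a σ) ≤ m

/-- The reconstruction number `r_m`: the smallest `r` such that any set of `r` participants can
recover `m` `q`-bits of information. -/
noncomputable def reconstructionNumber (scheme : CosetScheme C₂ C₁ k ℓ) (m : ℕ) : ℕ :=
  sInf {r : ℕ | ∀ A : Set ι, A.ncard = r → scheme.CanRecover A m}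

/-- `A` is non-`m`-qualifying. -/
def NonQualifying (scheme : CosetScheme C₂ C₁ k ℓ) (m : ℕ) (A : Set ι) : Prop :=
  ¬ scheme.CanRecover A m

/-- `A` is maximum non-`m`-qualifying: of largest possible size among the non-`m`-qualifying
sets. -/
def MaximumNonQualifying (scheme : CosetScheme C₂ C₁ k ℓ) (m : ℕ) (A : Set ι) : Prop :=
  scheme.NonQualifying m A ∧ ∀ B : Set ι, scheme.NonQualifying m B → B.ncard ≤ A.ncard

end CosetScheme

end Scheme

section MonomialCartesian

variable {m : ℕ} {F : Type*} [Field F]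

/-- The point set `S₁ × ⋯ × S_m`. -/
abbrev CartesianPoint (S : Fin m → Finset F) : Type _ := (t : Fin m) → S t

/-- Evaluation of polynomials at the points of `S₁ × ⋯ × S_m`. -/
noncomputable def cartesianEval (S : Fin m → Finset F) :
    MvPolynomial (Fin m) F →ₗ[F] (CartesianPoint S → F) :=
  LinearMap.pi fun p => (MvPolynomial.aeval fun t => (p t : F)).toLinearMap

/-- The monomial-Cartesian code `C(L)`. A monomial `X₁^{i₁} ⋯ X_m^{i_m}` is given by its exponent
vector. -/
noncomputable def monomialCartesianCode (S : Fin m → Finset F) (L : Finset (Fin m → ℕ)) :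
    Submodule F (CartesianPoint S → F) :=
  (Submodule.span F
    ((fun i : Fin m → ℕ => ∏ t, (MvPolynomial.X t : MvPolynomial (Fin m) F) ^ i t) '' ↑L)).map
    (cartesianEval S)

end MonomialCartesian

section Considerate

variable {m : ℕ}

/-- `Δ(s₁, …, s_m)`: the monomials with exponent of `X_t` less than `s_t` for all `t`. -/
def monomialDelta (s : Fin m → ℕ) : Finset (Fin m → ℕ) :=
  Fintype.piFinset fun t => Finset.range (s t)

open Classical in
/-- `D(K)`: the number of monomials in `Δ(s₁, …, s_m)` that are divisible by some monomial
in `K`. -/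
noncomputable def shadowSize (s : Fin m → ℕ) (K : Finset (Fin m → ℕ)) : ℕ :=
  ((monomialDelta s).filter fun N => ∃ M ∈ K, ∀ t, M t ≤ N t).card

/-- `L₁`: the monomials with exponents `0 ≤ i_t ≤ j_t`. -/
def considerateL1 (j : Fin m → ℕ) : Finset (Fin m → ℕ) :=
  Fintype.piFinset fun t => Finset.Icc 0 (j t)

/-- `□`: the monomials with exponents `v_t ≤ i_t ≤ j_t`. -/
def considerateBox (v j : Fin m → ℕ) : Finset (Fin m → ℕ) :=
  Fintype.piFinset fun t => Finset.Icc (v t) (j t)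

/-- `L₂ = L₁ \ □`. -/
def considerateL2 (v j : Fin m → ℕ) : Finset (Fin m → ℕ) :=
  considerateL1 j \ considerateBox v j

open Classical in
/-- `◇`: the monomials of `L₁` that are not smaller than `X₁^{v₁} ⋯ X_m^{v_m}` in the lexicographic
ordering with `X_m ≺ ⋯ ≺ X₂ ≺ X₁`. -/
noncomputable def considerateDiamond (v j : Fin m → ℕ) : Finset (Fin m → ℕ) :=
  (considerateL1 j).filter fun M => toLex v ≤ toLex M

/-- The scheme defined from `C(L₂) ⊆ C(L₁)` over a point set with `#S_t = s_t` is considerate: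
`0 ≤ v_t < j_t < s_t` for all `t`, and for `i = 1, …, #□` the smallest value of `D(K)` over all
`K ⊆ ◇` of size `i` is attained by some `K' ⊆ □`. -/
def IsConsiderate (s v j : Fin m → ℕ) : Prop :=
  (∀ t, v t < j t ∧ j t < s t) ∧
    ∀ i, 1 ≤ i → i ≤ (considerateBox v j).card →
      ∃ K' ⊆ considerateBox v j, K'.card = i ∧
        ∀ K ⊆ considerateDiamond v j, K.card = i → shadowSize s K' ≤ shadowSize s K

end Considerate

/-- `e = z(z-1) - h` with `√ℓ ≥ z ≥ 2` and `0 ≤ h < z - 1`. -/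
def IsPronicForm (ℓ e z h : ℕ) : Prop :=
  (e : ℤ) = z * (z - 1) - h ∧ (z : ℝ) ≤ √(ℓ : ℝ) ∧ 2 ≤ z ∧ (h : ℤ) < z - 1

/-- `e = z² - h` with `√ℓ ≥ z ≥ 1` and `0 ≤ h ≤ z - 1`. -/
def IsSquareForm (ℓ e z h : ℕ) : Prop :=
  (e : ℤ) = z ^ 2 - h ∧ (z : ℝ) ≤ √(ℓ : ℝ) ∧ 1 ≤ z ∧ (h : ℤ) ≤ z - 1

/-!
The words of `C(L₁)` are expanded in the basis of monomials and each nonzero word has a leading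
monomial. Multiplying the words of a subcode `E` by monomials shows that `#Supp E` is at least the
number of monomials of `Δ` that are divisible by a leading monomial of `E` (the footprint bound).
If `E ⊆ C(L₁)` has dimension `e`, its `e` leading monomials fit in a rectangle with sides `p` and
`q` in the upper right corner of `L₁`, where `p q ≥ e`, and with `a = s - j - 1` they divide at
least `a² + a (p + q) + e` monomials of `Δ`. So `M_e ≥ a² + a n + e`, where `n` is the smallest
half-perimeter of a rectangle of area at least `e`; situations (2) and (1) are those of `n = 2z`
and `n = 2z - 1`, and `h` is the area that is left over.

The bound is attained: the products of univariate polynomials that vanish outside `T₁` and `T₂`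
span a space of dimension `p q` whose leading monomials lie in `□`, and vanishing at `h` further
points costs at most `h` dimensions. Finally, a set `A` is non-`(ℓ - e + 1)`-qualifying precisely
when an `e`-dimensional subcode of `C₁` that meets `C₂` trivially vanishes on `A`, so the complement
of a largest such `A` has `M_e` points.
-/

section LinearAlgebra

variable {F V : Type*} [Field F] [AddCommGroup V] [Module F V]

theorem exists_submodule_finrank_eq (W : Submodule F V) {e : ℕ} (he : e ≤ Module.finrank F W) :
    ∃ D ≤ W, Module.finrank F D = e := by
  obtain ⟨f, hf⟩ := exists_linearIndependent_of_le_finrank he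
  have hf' : LinearIndependent F (W.subtype ∘ f) := hf.map' W.subtype W.ker_subtype
  refine ⟨Submodule.span F (Set.range (W.subtype ∘ f)), ?_, by simpa using finrank_span_eq_card hf'⟩
  rw [Submodule.span_le]
  rintro _ ⟨i, rfl⟩
  exact (f i).2

theorem exists_le_disjoint_finrank_eq_iff {X Y : Submodule F V} [FiniteDimensional F X] {e : ℕ} :
    (∃ D ≤ X, D ⊓ Y = ⊥ ∧ Module.finrank F D = e) ↔
      e + Module.finrank F ↥(X ⊓ Y) ≤ Module.finrank F X := by
  constructor
  · rintro ⟨D, hDX, hDY, rfl⟩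
    have := Submodule.finiteDimensional_of_le hDX
    have hdisjoint : D ⊓ (X ⊓ Y) = ⊥ := by rw [← inf_assoc, inf_eq_left.2 hDX, hDY]
    have hsup := Submodule.finrank_sup_add_finrank_inf_eq D (X ⊓ Y)
    rw [hdisjoint, finrank_bot, add_zero] at hsup
    exact hsup ▸ Submodule.finrank_mono (sup_le hDX inf_le_left)
  · intro he
    obtain ⟨Q, hQ⟩ := exists_isCompl (X ⊓ Y)
    have hsup : X ⊓ Y ⊔ Q ⊓ X = X := by
      rw [← sup_inf_assoc_of_le Q inf_le_left, hQ.sup_eq_top, top_inf_eq]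
    have hinf : Q ⊓ X ⊓ Y = ⊥ := by rw [inf_assoc, inf_comm, hQ.inf_eq_bot]
    have hdim := Submodule.finrank_sup_add_finrank_inf_eq (X ⊓ Y) (Q ⊓ X)
    rw [hsup, inf_comm (X ⊓ Y), ← inf_assoc, inf_assoc Q, inf_idem, hinf, finrank_bot] at hdim
    obtain ⟨D, hD, hDe⟩ := exists_submodule_finrank_eq (Q ⊓ X) (e := e) (by omega)
    exact ⟨D, hD.trans inf_le_right, eq_bot_mono (inf_le_inf_right Y hD) hinf, hDe⟩

variable {W : Type*} [AddCommGroup W] [Module F W]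

theorem finrank_map_add_finrank_ker_inf (f : V →ₗ[F] W) (p : Submodule F V)
    [FiniteDimensional F p] :
    Module.finrank F (p.map f) + Module.finrank F ↥(LinearMap.ker f ⊓ p) = Module.finrank F p := by
  rw [← LinearMap.finrank_range_add_finrank_ker (f.domRestrict p), LinearMap.range_domRestrict,
    LinearMap.ker_domRestrict, ← Submodule.finrank_map_subtype_eq, Submodule.map_comap_subtype,
    inf_comm]

theorem finrank_comap_of_injective {f : V →ₗ[F] W} (hf : Function.Injective f)
    {p : Submodule F W} (hp : p ≤ LinearMap.range f) :
    Module.finrank F (p.comap f) = Module.finrank F p := by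
  rw [(Submodule.equivMapOfInjective f hf _).finrank_eq, Submodule.map_comap_eq_of_le hp]

end LinearAlgebra

section Scheme

variable {F ι : Type*} [Field F]

variable (F) in
/-- The words of `F^ι` that are zero at all positions in `A`. -/
def vanishingOn (A : Set ι) : Submodule F (ι → F) :=
  LinearMap.ker (LinearMap.funLeft F F (Subtype.val : A → ι))

theorem mem_vanishingOn {A : Set ι} {f : ι → F} : f ∈ vanishingOn F A ↔ ∀ i ∈ A, f i = 0 := by
  simp [vanishingOn, funext_iff]

theorem vanishingOn_anti {A B : Set ι} (h : A ⊆ B) : vanishingOn F B ≤ vanishingOn F A :=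
  fun _ hf => mem_vanishingOn.2 fun i hi => mem_vanishingOn.1 hf i (h hi)

theorem vanishingOn_union (A B : Set ι) :
    vanishingOn F (A ∪ B) = vanishingOn F A ⊓ vanishingOn F B := by
  ext f
  simp only [mem_vanishingOn, Submodule.mem_inf, Set.mem_union, or_imp, forall_and]

theorem le_vanishingOn_iff {D : Submodule F (ι → F)} {A : Set ι} :
    D ≤ vanishingOn F A ↔ {i : ι | ∃ c ∈ D, c i ≠ 0} ⊆ Aᶜ := by
  simp only [SetLike.le_def, mem_vanishingOn, Set.subset_def, Set.mem_ofPred_eq, Set.mem_compl_iff]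
  grind

theorem finrank_vanishingOn_add_ncard [Finite ι] (A : Set ι) :
    Module.finrank F (vanishingOn F A) + A.ncard = Nat.card ι := by
  have := Fintype.ofFinite ι
  have := Fintype.ofFinite A
  have hrank := LinearMap.finrank_range_add_finrank_ker
    (LinearMap.funLeft F F (Subtype.val : A → ι))
  rw [LinearMap.range_eq_top.2 (LinearMap.funLeft_surjective_of_injective F F _
    Subtype.val_injective), finrank_top, Module.finrank_fintype_fun_eq_card,
    Module.finrank_fintype_fun_eq_card, ← Nat.card_eq_fintype_card, ← Nat.card_eq_fintype_card,
    Nat.card_coe_set_eq] at hrank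
  rwa [add_comm]

theorem finrank_le_finrank_inf_vanishingOn_add_ncard [Finite ι] (G : Submodule F (ι → F))
    (U : Set ι) :
    Module.finrank F G ≤ Module.finrank F ↥(G ⊓ vanishingOn F U) + U.ncard := by
  have := Fintype.ofFinite ι
  have hsup := Submodule.finrank_sup_add_finrank_inf_eq G (vanishingOn F U)
  have hle := Submodule.finrank_le (G ⊔ vanishingOn F U)
  have hU := finrank_vanishingOn_add_ncard (F := F) U
  rw [Module.finrank_fintype_fun_eq_card, ← Nat.card_eq_fintype_card] at hle
  omega

/-- The subcodes over which the relative generalized Hamming weight `M_e(C₁, C₂)` is minimised: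
the `e`-dimensional subcodes of `C₁` that meet `C₂` trivially. -/
def IsRelativeSubcode (C₁ C₂ : Submodule F (ι → F)) (e : ℕ) (D : Submodule F (ι → F)) : Prop :=
  D ≤ C₁ ∧ D ⊓ C₂ = ⊥ ∧ Module.finrank F D = e

variable {C₂ C₁ D : Submodule F (ι → F)} {e : ℕ}

theorem relGenHammingWeight_le_supportSize (hD : IsRelativeSubcode C₁ C₂ e D) :
    relGenHammingWeight C₁ C₂ e ≤ supportSize D :=
  Nat.sInf_le ⟨D, hD.1, hD.2.1, hD.2.2, rfl⟩

theorem exists_supportSize_eq_relGenHammingWeight (h : ∃ D, IsRelativeSubcode C₁ C₂ e D) :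
    ∃ D, IsRelativeSubcode C₁ C₂ e D ∧ supportSize D = relGenHammingWeight C₁ C₂ e := by
  obtain ⟨D, hDC₁, hDC₂, hDe⟩ := h
  obtain ⟨D', hDC₁', hDC₂', hDe', hw⟩ := Nat.sInf_mem
    (s := {w | ∃ D, D ≤ C₁ ∧ D ⊓ C₂ = ⊥ ∧ Module.finrank F D = e ∧ supportSize D = w})
    ⟨_, D, hDC₁, hDC₂, hDe, rfl⟩
  exact ⟨D', ⟨hDC₁', hDC₂', hDe'⟩, hw⟩

theorem IsRelativeSubcode.exists_le_vanishingOn_diff [Finite ι] {q h : ℕ} {A U : Set ι}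
    (hD : IsRelativeSubcode C₁ C₂ q D) (hA : D ≤ vanishingOn F Aᶜ) (hU : U.ncard ≤ h)
    (hq : e + h = q) :
    ∃ E, IsRelativeSubcode C₁ C₂ e E ∧ E ≤ vanishingOn F (A \ U)ᶜ := by
  obtain ⟨hDC₁, hDC₂, hDq⟩ := hD
  have hdim := finrank_le_finrank_inf_vanishingOn_add_ncard D U
  obtain ⟨E, hE, hEe⟩ := exists_submodule_finrank_eq (D ⊓ vanishingOn F U) (e := e) (by omega)
  have hED := hE.trans inf_le_left
  refine ⟨E, ⟨hED.trans hDC₁, eq_bot_mono (inf_le_inf_right C₂ hED) hDC₂, hEe⟩, ?_⟩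
  rw [Set.compl_sdiff, vanishingOn_union]
  exact le_inf (hE.trans inf_le_right) (hED.trans hA)

namespace CosetScheme

variable {k ℓ : ℕ} (scheme : CosetScheme C₂ C₁ k ℓ)

/-- The dealing of shares as a linear map of the random coefficients and the secret. -/
def encodeLin : ((Fin k → F) × (Fin ℓ → F)) →ₗ[F] (ι → F) :=
  (Fintype.linearCombination F scheme.mask).coprod (Fintype.linearCombination F scheme.payload)

theorem encodeLin_apply (a : Fin k → F) (σ : Fin ℓ → F) :
    scheme.encodeLin (a, σ) = scheme.encode a σ := by
  simp [encodeLin, encode, Fintype.linearCombination_apply]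

theorem encodeLin_injective : Function.Injective scheme.encodeLin := by
  rw [injective_iff_map_eq_zero]
  rintro ⟨a, σ⟩ h
  have hzero := Fintype.linearIndependent_iff.mp scheme.linearIndependent (Sum.elim a σ) (by
    rw [encodeLin_apply, encode] at h
    simpa using h)
  exact Prod.ext (funext fun i => hzero (Sum.inl i)) (funext fun i => hzero (Sum.inr i))

theorem range_encodeLin : LinearMap.range scheme.encodeLin = C₁ := by
  rw [encodeLin, LinearMap.range_coprod, Fintype.range_linearCombination,
    Fintype.range_linearCombination, ← Submodule.span_union, ← Set.Sum.elim_range,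
    scheme.span_mask_payload]

theorem sub_code_le_code (scheme : CosetScheme C₂ C₁ k ℓ) : C₂ ≤ C₁ :=
  calc
    C₂ = Submodule.span F (Set.range scheme.mask) := scheme.span_mask.symm
    _ ≤ Submodule.span F (Set.range (Sum.elim scheme.mask scheme.payload)) :=
      Submodule.span_mono (Set.range_subset_iff.2 fun t => ⟨Sum.inl t, rfl⟩)
    _ = C₁ := scheme.span_mask_payload

theorem ker_snd_eq_comap_encodeLin :
    LinearMap.ker (LinearMap.snd F (Fin k → F) (Fin ℓ → F)) = C₂.comap scheme.encodeLin := by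
  have hmap : (LinearMap.range (LinearMap.inl F (Fin k → F) (Fin ℓ → F))).map scheme.encodeLin =
      C₂ := by
    rw [← LinearMap.range_comp, encodeLin, LinearMap.coprod_inl, Fintype.range_linearCombination,
      scheme.span_mask]
  calc
    _ = LinearMap.range (LinearMap.inl F (Fin k → F) (Fin ℓ → F)) :=
      (LinearMap.range_inl F _ _).symm
    _ = Submodule.comap scheme.encodeLin _ :=
      (Submodule.comap_map_eq_of_injective scheme.encodeLin_injective _).symm
    _ = _ := congrArg _ hmap

theorem finiteDimensional (scheme : CosetScheme C₂ C₁ k ℓ) : FiniteDimensional F C₁ :=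
  scheme.range_encodeLin ▸ inferInstance

theorem finrank_sub_code (scheme : CosetScheme C₂ C₁ k ℓ) : Module.finrank F C₂ = k := by
  have hmask := finrank_span_eq_card (scheme.linearIndependent.comp Sum.inl Sum.inl_injective)
  rwa [Sum.elim_comp_inl, scheme.span_mask, Fintype.card_fin] at hmask

theorem finrank_code (scheme : CosetScheme C₂ C₁ k ℓ) : Module.finrank F C₁ = k + ℓ := by
  have hcard := finrank_span_eq_card scheme.linearIndependent
  rwa [scheme.span_mask_payload, Fintype.card_sum, Fintype.card_fin, Fintype.card_fin] at hcard

theorem exists_isRelativeSubcode (scheme : CosetScheme C₂ C₁ k ℓ) (he : e ≤ ℓ) :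
    ∃ D, IsRelativeSubcode C₁ C₂ e D := by
  have := scheme.finiteDimensional
  refine exists_le_disjoint_finrank_eq_iff.2 ?_
  rw [inf_eq_right.2 scheme.sub_code_le_code, scheme.finrank_sub_code, scheme.finrank_code]
  omega

/-- The secrets that are in accordance with all shares of `A` being zero. The set of possible
secrets is always a translate of this space. -/
def hiddenSecrets (A : Set ι) : Submodule F (Fin ℓ → F) :=
  ((vanishingOn F A).comap scheme.encodeLin).map (LinearMap.snd F _ _)

theorem mem_hiddenSecrets {A : Set ι} {σ : Fin ℓ → F} :
    σ ∈ scheme.hiddenSecrets A ↔ ∃ a, ∀ i ∈ A, scheme.encode a σ i = 0 := by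
  simp [hiddenSecrets, mem_vanishingOn, encodeLin_apply]

theorem possibleSecrets_encode (A : Set ι) (a : Fin k → F) (σ : Fin ℓ → F) :
    scheme.possibleSecrets A (scheme.encode a σ) =
      (AffineSubspace.mk' σ (scheme.hiddenSecrets A) : Set (Fin ℓ → F)) := by
  ext τ
  have hsub (x y : Fin k → F) (i : ι) :
      scheme.encode (x - y) (τ - σ) i = scheme.encode x τ i - scheme.encode y σ i := by
    simp only [← encodeLin_apply, ← Prod.mk_sub_mk, map_sub, Pi.sub_apply]
  rw [SetLike.mem_coe, AffineSubspace.mem_mk', vsub_eq_sub, mem_hiddenSecrets]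
  constructor
  · rintro ⟨x, hx⟩
    exact ⟨x - a, fun i hi => by rw [hsub, hx i hi, sub_self]⟩
  · rintro ⟨x, hx⟩
    exact ⟨x + a, fun i hi => by rw [← sub_eq_zero, ← hsub, add_sub_cancel_right, hx i hi]⟩

theorem information_encode (A : Set ι) (a : Fin k → F) (σ : Fin ℓ → F) :
    scheme.information A (scheme.encode a σ) = ℓ - Module.finrank F (scheme.hiddenSecrets A) := by
  rw [information, possibleSecrets_encode, ← AffineSubspace.direction_eq_vectorSpan,
    AffineSubspace.direction_mk']

theorem finrank_hiddenSecrets_add (A : Set ι) :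
    Module.finrank F (scheme.hiddenSecrets A) + Module.finrank F ↥(C₂ ⊓ vanishingOn F A) =
      Module.finrank F ↥(C₁ ⊓ vanishingOn F A) := by
  have hmap := finrank_map_add_finrank_ker_inf (LinearMap.snd F (Fin k → F) (Fin ℓ → F))
    ((vanishingOn F A).comap scheme.encodeLin)
  have hcomap : (vanishingOn F A).comap scheme.encodeLin =
      (C₁ ⊓ vanishingOn F A).comap scheme.encodeLin := by
    ext x
    have hx : scheme.encodeLin x ∈ C₁ := scheme.range_encodeLin.le ⟨x, rfl⟩
    simp only [Submodule.mem_comap, Submodule.mem_inf, hx, true_and]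
  rw [ker_snd_eq_comap_encodeLin, ← Submodule.comap_inf, finrank_comap_of_injective
    scheme.encodeLin_injective
    (inf_le_left.trans (scheme.sub_code_le_code.trans scheme.range_encodeLin.ge))] at hmap
  rw [hiddenSecrets, hmap, hcomap, finrank_comap_of_injective scheme.encodeLin_injective
    (inf_le_left.trans scheme.range_encodeLin.ge)]

theorem obtainsAtMost_iff_nonQualifying {A : Set ι} {m : ℕ} :
    scheme.ObtainsAtMost A m ↔ scheme.NonQualifying (m + 1) A := by
  simp [ObtainsAtMost, NonQualifying, CanRecover, information_encode]

theorem nonQualifying_iff_exists_isRelativeSubcode (he : e ≤ ℓ) {A : Set ι} :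
    scheme.NonQualifying (ℓ - e + 1) A ↔
      ∃ D, IsRelativeSubcode C₁ C₂ e D ∧ D ≤ vanishingOn F A := by
  have := scheme.finiteDimensional
  have hle : Module.finrank F (scheme.hiddenSecrets A) ≤ ℓ := by
    simpa using Submodule.finrank_le (scheme.hiddenSecrets A)
  have hadd := scheme.finrank_hiddenSecrets_add A
  have hinf : C₁ ⊓ vanishingOn F A ⊓ C₂ = C₂ ⊓ vanishingOn F A := by
    rw [inf_right_comm, inf_eq_right.2 scheme.sub_code_le_code]
  calc
    _ ↔ e + Module.finrank F ↥(C₁ ⊓ vanishingOn F A ⊓ C₂) ≤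
        Module.finrank F ↥(C₁ ⊓ vanishingOn F A) := by
      simp only [NonQualifying, CanRecover, information_encode, forall_const]
      rw [hinf]
      omega
    _ ↔ _ := by
      rw [← exists_le_disjoint_finrank_eq_iff]
      simp only [IsRelativeSubcode, le_inf_iff]
      grind

variable [Finite ι]

theorem ncard_add_relGenHammingWeight_le (he : e ≤ ℓ) {A : Set ι}
    (hA : scheme.NonQualifying (ℓ - e + 1) A) :
    A.ncard + relGenHammingWeight C₁ C₂ e ≤ Nat.card ι := by
  obtain ⟨D, hD, hDA⟩ := (scheme.nonQualifying_iff_exists_isRelativeSubcode he).1 hA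
  have hsupp : supportSize D ≤ Aᶜ.ncard := Set.ncard_le_ncard (le_vanishingOn_iff.1 hDA)
  have hcompl := Set.ncard_add_ncard_compl A
  have hmin := relGenHammingWeight_le_supportSize hD
  omega

theorem exists_nonQualifying_ncard_add_relGenHammingWeight_eq (he : e ≤ ℓ) :
    ∃ A, scheme.NonQualifying (ℓ - e + 1) A ∧
      A.ncard + relGenHammingWeight C₁ C₂ e = Nat.card ι := by
  obtain ⟨D, hD, hmin⟩ :=
    exists_supportSize_eq_relGenHammingWeight (scheme.exists_isRelativeSubcode he)
  refine ⟨{i | ∃ c ∈ D, c i ≠ 0}ᶜ, (scheme.nonQualifying_iff_exists_isRelativeSubcode he).2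
    ⟨D, hD, le_vanishingOn_iff.2 (compl_compl _).ge⟩, ?_⟩
  rw [← hmin, supportSize, add_comm, Set.ncard_add_ncard_compl]

theorem reconstructionNumber_add_relGenHammingWeight (he : e ≤ ℓ) :
    scheme.reconstructionNumber (ℓ - e + 1) + relGenHammingWeight C₁ C₂ e = Nat.card ι + 1 := by
  obtain ⟨B, hB, hcard⟩ := scheme.exists_nonQualifying_ncard_add_relGenHammingWeight_eq he
  have hmem : ∀ A : Set ι, A.ncard = B.ncard + 1 → scheme.CanRecover A (ℓ - e + 1) := by
    intro A hA
    by_contra hnot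
    have := scheme.ncard_add_relGenHammingWeight_le he hnot
    omega
  suffices scheme.reconstructionNumber (ℓ - e + 1) = B.ncard + 1 by omega
  refine le_antisymm (Nat.sInf_le hmem) (le_csInf ⟨_, hmem⟩ fun r hr => ?_)
  by_contra! hlt
  obtain ⟨A, hAB, hAr⟩ := Set.exists_subset_card_eq (Nat.lt_succ_iff.1 hlt)
  obtain ⟨D, hD, hDB⟩ := (scheme.nonQualifying_iff_exists_isRelativeSubcode he).1 hB
  exact (scheme.nonQualifying_iff_exists_isRelativeSubcode he).2
    ⟨D, hD, hDB.trans (vanishingOn_anti hAB)⟩ (hr A hAr)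

theorem maximumNonQualifying_iff_ncard_add_eq (he : e ≤ ℓ) {A : Set ι}
    (hA : scheme.NonQualifying (ℓ - e + 1) A) :
    scheme.MaximumNonQualifying (ℓ - e + 1) A ↔
      A.ncard + relGenHammingWeight C₁ C₂ e = Nat.card ι := by
  obtain ⟨B, hB, hcard⟩ := scheme.exists_nonQualifying_ncard_add_relGenHammingWeight_eq he
  have hle := scheme.ncard_add_relGenHammingWeight_le he hA
  refine ⟨fun h => ?_, fun h => ⟨hA, fun A' hA' => ?_⟩⟩
  · have := h.2 B hB
    omega
  · have := scheme.ncard_add_relGenHammingWeight_le he hA'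
    omega

end CosetScheme

end Scheme

section LeadingIndex

variable {I F V : Type*} [LinearOrder I] [Field F] [AddCommGroup V] [Module F V]

/-- `N` is the leading index of `f` with respect to the ordered basis `b`: the largest index with a
nonzero coefficient. -/
def IsLead (b : Module.Basis I F V) (f : V) (N : I) : Prop :=
  IsGreatest ((b.repr f).support : Set I) N

/-- The leading indices of the nonzero elements of `D`. -/
def leadSet (b : Module.Basis I F V) (D : Submodule F V) : Set I :=
  {N | ∃ f ∈ D, IsLead b f N}

variable {b : Module.Basis I F V} {f : V} {N : I}

theorem isLead_iff : IsLead b f N ↔ b.repr f N ≠ 0 ∧ ∀ M, b.repr f M ≠ 0 → M ≤ N := by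
  simp [IsLead, IsGreatest, upperBounds]

theorem IsLead.ne_zero (h : IsLead b f N) : f ≠ 0 := by
  rintro rfl
  exact (isLead_iff.1 h).1 (by simp)

theorem isLead_self (b : Module.Basis I F V) (N : I) : IsLead b (b N) N := by
  simp [isLead_iff, Finsupp.single_apply]

theorem exists_isLead (b : Module.Basis I F V) (hf : f ≠ 0) : ∃ N, IsLead b f N :=
  ⟨_, Finset.isGreatest_max' _ (by simpa using hf)⟩

theorem inf_eq_bot_of_disjoint_leadSet {D E : Submodule F V}
    (h : Disjoint (leadSet b D) (leadSet b E)) : D ⊓ E = ⊥ := by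
  rw [Submodule.eq_bot_iff]
  intro f hf
  by_contra hne
  obtain ⟨N, hN⟩ := exists_isLead b hne
  exact Set.disjoint_left.1 h ⟨f, hf.1, hN⟩ ⟨f, hf.2, hN⟩

section Family

variable {κ : Type*} {g : κ → V} {n : κ → I}

theorem exists_isLead_linearCombination (hn : Function.Injective n)
    (hg : ∀ x, IsLead b (g x) (n x)) {c : κ →₀ F} (hc : c ≠ 0) :
    ∃ x, IsLead b (Finsupp.linearCombination F g c) (n x) := by
  have hrepr (M : I) : b.repr (Finsupp.linearCombination F g c) M =
      ∑ y ∈ c.support, c y * b.repr (g y) M := by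
    simp [Finsupp.linearCombination_apply, Finsupp.sum, Finsupp.finsetSum_apply]
  obtain ⟨x, hx, hmax⟩ := c.support.exists_max_image n (by simpa using hc)
  refine ⟨x, isLead_iff.2 ⟨?_, fun M hM => ?_⟩⟩
  · rw [hrepr, Finset.sum_eq_single_of_mem x hx]
    · exact mul_ne_zero (Finsupp.mem_support_iff.1 hx) (isLead_iff.1 (hg x)).1
    · intro y hy hyx
      by_contra hne
      exact hyx (hn ((hmax y hy).antisymm ((isLead_iff.1 (hg y)).2 _ (right_ne_zero_of_mul hne))))
  · rw [hrepr] at hM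
    obtain ⟨y, hy, hyM⟩ := Finset.exists_ne_zero_of_sum_ne_zero hM
    exact ((isLead_iff.1 (hg y)).2 M (right_ne_zero_of_mul hyM)).trans (hmax y hy)

theorem linearIndependent_of_isLead (hn : Function.Injective n)
    (hg : ∀ x, IsLead b (g x) (n x)) : LinearIndependent F g := by
  rw [linearIndependent_iff]
  intro c hc
  by_contra hne
  obtain ⟨x, hx⟩ := exists_isLead_linearCombination hn hg hne
  exact hx.ne_zero hc

theorem leadSet_span_range (hn : Function.Injective n)
    (hg : ∀ x, IsLead b (g x) (n x)) :
    leadSet b (Submodule.span F (Set.range g)) = Set.range n := by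
  refine subset_antisymm ?_
    (Set.range_subset_iff.2 fun x => ⟨g x, Submodule.subset_span ⟨x, rfl⟩, hg x⟩)
  rintro N ⟨f, hf, hN⟩
  obtain ⟨c, rfl⟩ := (Finsupp.mem_span_range_iff_exists_finsupp).1 hf
  have hc : c ≠ 0 := by
    rintro rfl
    exact hN.ne_zero (by simp)
  obtain ⟨x, hx⟩ := exists_isLead_linearCombination hn hg hc
  exact ⟨x, hx.unique hN⟩

end Family

theorem ncard_leadSet [Finite I] (b : Module.Basis I F V) (D : Submodule F V) :
    (leadSet b D).ncard = Module.finrank F D := by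
  have := Fintype.ofFinite I
  have := Fintype.ofFinite (leadSet b D)
  have := b.finiteDimensional_of_finite
  rw [← Nat.card_coe_set_eq, Nat.card_eq_fintype_card]
  apply le_antisymm
  · choose g hg hlead using fun N : leadSet b D => N.2
    have hindep : LinearIndependent F (D.subtype ∘ fun N => (⟨g N, hg N⟩ : D)) :=
      linearIndependent_of_isLead Subtype.val_injective hlead
    exact (hindep.of_comp D.subtype).fintype_card_le_finrank
  · let coeffs : D →ₗ[F] leadSet b D → F :=
      LinearMap.funLeft F F Subtype.val ∘ₗ b.equivFun.toLinearMap ∘ₗ D.subtype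
    have hcoeffs : Function.Injective coeffs := by
      rw [injective_iff_map_eq_zero]
      intro f hf
      by_contra hne
      obtain ⟨N, hN⟩ := exists_isLead b (Subtype.coe_ne_coe.2 hne)
      exact (isLead_iff.1 hN).1 (congrFun hf ⟨N, f, f.2, hN⟩)
    simpa using LinearMap.finrank_le_finrank_of_injective hcoeffs

end LeadingIndex

section Grid

variable {m : ℕ}

theorem considerateL1_subset_monomialDelta {s j : Fin m → ℕ} (hj : ∀ t, j t < s t) :
    considerateL1 j ⊆ monomialDelta s :=
  Fintype.piFinset_subset _ _ fun t _ ha =>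
    Finset.mem_range.2 ((Finset.mem_Icc.1 ha).2.trans_lt (hj t))

variable {F : Type*} (S : Fin m → Finset F)

/-- The exponent vectors of the monomials in `Δ(#S₁, …, #S_m)`, in the lexicographic ordering. They
index a basis of the words on the grid `S₁ × ⋯ × S_m`. -/
abbrev GridIndex : Type := Lex (∀ t, Fin (S t).card)

namespace GridIndex

variable {S}

/-- The exponent vector as a vector of natural numbers. -/
def exponent (n : GridIndex S) : Fin m → ℕ := fun t => ofLex n t

theorem exponent_lt (n : GridIndex S) (t : Fin m) : n.exponent t < (S t).card := (ofLex n t).2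

theorem toLex_exponent_strictMono : StrictMono fun n : GridIndex S => toLex n.exponent :=
  fun _ _ ⟨t, heq, hlt⟩ => ⟨t, fun u hu => congrArg Fin.val (heq u hu), hlt⟩

theorem exponent_injective : Function.Injective (exponent (S := S)) :=
  toLex_exponent_strictMono.injective.of_comp (f := toLex)

theorem mem_range_exponent {a : Fin m → ℕ} :
    a ∈ Set.range (exponent (S := S)) ↔ a ∈ monomialDelta fun t => (S t).card := by
  simp only [monomialDelta, Fintype.mem_piFinset, Finset.mem_range]
  exact ⟨fun ⟨n, hn⟩ => hn ▸ n.exponent_lt, fun ha => ⟨toLex fun t => ⟨a t, ha t⟩, rfl⟩⟩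

theorem ncard_preimage_exponent {L : Finset (Fin m → ℕ)}
    (hL : L ⊆ monomialDelta fun t => (S t).card) :
    (exponent (S := S) ⁻¹' L).ncard = L.card := by
  rw [Set.ncard_preimage_of_injective_subset_range exponent_injective
    fun a ha => mem_range_exponent.2 (hL ha), Set.ncard_coe_finset]

end GridIndex

variable [Field F]

open GridIndex Polynomial

/-- The evaluation of `P₁(X₁) ⋯ P_m(X_m)` at the points of the grid. -/
noncomputable def productWord (P : Fin m → F[X]) : CartesianPoint S → F :=
  fun x => ∏ t, (P t).eval (x t : F)

/-- The evaluation of a monomial, given by its exponent vector, at the points of the grid. -/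
noncomputable def monomialWord (a : Fin m → ℕ) : CartesianPoint S → F :=
  productWord S fun t => X ^ a t

theorem productWord_mul (P Q : Fin m → F[X]) :
    productWord S P * productWord S Q = productWord S fun t => P t * Q t := by
  ext x
  simp [productWord, Finset.prod_mul_distrib]

theorem monomialWord_add (a b : Fin m → ℕ) :
    monomialWord S (a + b) = monomialWord S a * monomialWord S b := by
  simp only [monomialWord, productWord_mul, Pi.add_apply, pow_add]

theorem productWord_modByMonic_nodal (P : Fin m → F[X]) :
    productWord S (fun t => P t %ₘ Lagrange.nodal (S t) id) = productWord S P := by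
  ext x
  refine Finset.prod_congr rfl fun t _ => ?_
  exact eval₂_modByMonic_eq_self_of_root (Lagrange.eval_nodal_at_node (v := id) (x t).2)

theorem productWord_eq_sum_of_degree_lt {P : Fin m → F[X]} (hP : ∀ t, (P t).degree < (S t).card) :
    productWord S P =
      ∑ n : GridIndex S, (∏ t, (P t).coeff (n.exponent t)) • monomialWord S n.exponent := by
  ext x
  have heval (t : Fin m) : (P t).eval (x t : F) =
      ∑ i : Fin (S t).card, (P t).coeff i * (x t : F) ^ (i : ℕ) := by
    rw [eval_eq_sum_degreeLTEquiv (mem_degreeLT.2 (hP t))]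
    rfl
  simp only [monomialWord, productWord, heval, Finset.prod_univ_sum, Fintype.piFinset_univ,
    Finset.sum_apply, Pi.smul_apply, smul_eq_mul, eval_pow, eval_X, ← Finset.prod_mul_distrib]
  rfl

theorem single_one_eq_productWord [DecidableEq F] (x : CartesianPoint S) :
    Pi.single x 1 = productWord S fun t => Lagrange.basis (S t) id (x t : F) := by
  ext y
  by_cases hxy : y = x
  · subst hxy
    rw [Pi.single_eq_same, productWord]
    exact (Finset.prod_eq_one fun t _ => Lagrange.eval_basis_self (v := id)
      Function.injective_id.injOn (y t).2).symm
  · obtain ⟨t, ht⟩ := Function.ne_iff.1 hxy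
    rw [Pi.single_eq_of_ne hxy, productWord]
    exact (Finset.prod_eq_zero (Finset.mem_univ t) (Lagrange.eval_basis_of_ne (v := id)
      (Subtype.coe_ne_coe.2 ht.symm) (y t).2)).symm

theorem span_monomialWord_eq_top :
    Submodule.span F (Set.range fun n : GridIndex S => monomialWord S n.exponent) = ⊤ := by
  classical
  rw [eq_top_iff, ← (Pi.basisFun F (CartesianPoint S)).span_eq, Submodule.span_le]
  rintro _ ⟨x, rfl⟩
  rw [Pi.basisFun_apply, single_one_eq_productWord, productWord_eq_sum_of_degree_lt]
  · exact Submodule.sum_mem _ fun n _ =>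
      Submodule.smul_mem _ _ (Submodule.subset_span ⟨n, rfl⟩)
  · intro t
    rw [Lagrange.degree_basis Function.injective_id.injOn (x t).2]
    exact_mod_cast Nat.sub_lt (Finset.card_pos.2 ⟨_, (x t).2⟩) one_pos

/-- The basis of `F^{S₁ × ⋯ × S_m}` of the evaluations of the monomials in `Δ(#S₁, …, #S_m)`. -/
noncomputable def gridBasis : Module.Basis (GridIndex S) F (CartesianPoint S → F) :=
  basisOfTopLeSpanOfCardEqFinrank (fun n => monomialWord S n.exponent)
    (span_monomialWord_eq_top S).ge (by
      rw [Module.finrank_fintype_fun_eq_card, Fintype.card_lex]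
      simp)

theorem gridBasis_apply (n : GridIndex S) : gridBasis S n = monomialWord S n.exponent := by
  simp [gridBasis]

theorem gridBasis_repr_productWord_of_degree_lt {P : Fin m → F[X]}
    (hP : ∀ t, (P t).degree < (S t).card) (n : GridIndex S) :
    (gridBasis S).repr (productWord S P) n = ∏ t, (P t).coeff (n.exponent t) := by
  simp only [productWord_eq_sum_of_degree_lt S hP, ← gridBasis_apply]
  rw [Module.Basis.repr_sum_self]

theorem exponent_le_natDegree_of_gridBasis_repr_ne_zero {P : Fin m → F[X]} {n : GridIndex S}
    (hn : (gridBasis S).repr (productWord S P) n ≠ 0) (t : Fin m) :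
    n.exponent t ≤ (P t).natDegree := by
  have hmonic (t : Fin m) : (Lagrange.nodal (S t) id).Monic := Lagrange.nodal_monic
  rw [← productWord_modByMonic_nodal, gridBasis_repr_productWord_of_degree_lt] at hn
  · exact (le_natDegree_of_ne_zero (Finset.prod_ne_zero_iff.1 hn t (Finset.mem_univ t))).trans
      natDegree_modByMonic_le_left
  · exact fun t => (degree_modByMonic_lt _ (hmonic t)).trans_eq Lagrange.degree_nodal

theorem isLead_productWord {P : Fin m → F[X]} (hP : ∀ t, (P t).Monic) {n : GridIndex S}
    (hn : ∀ t, n.exponent t = (P t).natDegree) : IsLead (gridBasis S) (productWord S P) n := by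
  refine isLead_iff.2 ⟨?_, fun M hM => ?_⟩
  · rw [gridBasis_repr_productWord_of_degree_lt]
    · exact Finset.prod_ne_zero_iff.2 fun t _ => by simp [hn, (hP t).coeff_natDegree]
    · intro t
      exact degree_le_natDegree.trans_lt (by exact_mod_cast hn t ▸ n.exponent_lt t)
  · refine toLex_exponent_strictMono.le_iff_le.1 (Pi.toLex_monotone fun t => ?_)
    exact (exponent_le_natDegree_of_gridBasis_repr_ne_zero S hM t).trans_eq (hn t).symm

variable {S}

theorem gridBasis_repr_mul_monomialWord (f : CartesianPoint S → F) (a : Fin m → ℕ)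
    (n : GridIndex S) :
    (gridBasis S).repr (f * monomialWord S a) n = ∑ M : GridIndex S,
      (gridBasis S).repr f M * (gridBasis S).repr (monomialWord S (M.exponent + a)) n := by
  conv_lhs => rw [← (gridBasis S).sum_repr f, Finset.sum_mul]
  simp only [smul_mul_assoc, gridBasis_apply, ← monomialWord_add, map_sum, map_smul,
    Finsupp.finsetSum_apply, Finsupp.smul_apply, smul_eq_mul]

theorem IsLead.mul_monomialWord {f : CartesianPoint S → F} {N N' : GridIndex S}
    (hf : IsLead (gridBasis S) f N) {a : Fin m → ℕ} (ha : N'.exponent = N.exponent + a) :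
    IsLead (gridBasis S) (f * monomialWord S a) N' := by
  have hle {M n : GridIndex S}
      (hn : (gridBasis S).repr (monomialWord S (M.exponent + a)) n ≠ 0) (t : Fin m) :
      n.exponent t ≤ M.exponent t + a t := by
    simpa using exponent_le_natDegree_of_gridBasis_repr_ne_zero S hn t
  refine isLead_iff.2 ⟨?_, fun n hn => ?_⟩
  · rw [gridBasis_repr_mul_monomialWord, Finset.sum_eq_single_of_mem N (Finset.mem_univ N)]
    · simp only [← ha, ← gridBasis_apply, Module.Basis.repr_self, Finsupp.single_eq_same, mul_one]
      exact (isLead_iff.1 hf).1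
    · intro M _ hMN
      by_contra hne
      have hNM : N ≤ M := toLex_exponent_strictMono.le_iff_le.1 <| Pi.toLex_monotone fun t => by
        have := hle (right_ne_zero_of_mul hne) t
        rw [ha] at this
        exact Nat.add_le_add_iff_right.1 this
      exact hMN (((isLead_iff.1 hf).2 M (left_ne_zero_of_mul hne)).antisymm hNM)
  · rw [gridBasis_repr_mul_monomialWord] at hn
    obtain ⟨M, -, hM⟩ := Finset.exists_ne_zero_of_sum_ne_zero hn
    have hMN : M ≤ N := (isLead_iff.1 hf).2 M (left_ne_zero_of_mul hM)
    refine toLex_exponent_strictMono.le_iff_le.1 ?_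
    calc
      toLex n.exponent ≤ toLex M.exponent + toLex a :=
        Pi.toLex_monotone (hle (right_ne_zero_of_mul hM))
      _ ≤ toLex N.exponent + toLex a :=
        add_le_add_left (toLex_exponent_strictMono.monotone hMN) _
      _ = toLex N'.exponent := congrArg toLex ha.symm

theorem shadowSize_le_supportSize {D : Submodule F (CartesianPoint S → F)}
    {K : Finset (Fin m → ℕ)} (hK : (K : Set (Fin m → ℕ)) ⊆ exponent '' leadSet (gridBasis S) D) :
    shadowSize (fun t => (S t).card) K ≤ supportSize D := by
  classical
  let supp : Set (CartesianPoint S) := {x | ∃ c ∈ D, c x ≠ 0}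
  have hD : D ≤ vanishingOn F suppᶜ := le_vanishingOn_iff.2 (compl_compl _).ge
  have hsupp : supportSize D = (leadSet (gridBasis S) (vanishingOn F suppᶜ)).ncard := by
    have hrank := finrank_vanishingOn_add_ncard (F := F) suppᶜ
    have hcompl := Set.ncard_add_ncard_compl supp
    rw [ncard_leadSet]
    change supp.ncard = _
    omega
  rw [hsupp, shadowSize, ← Set.ncard_coe_finset,
    ← Set.ncard_image_of_injective _ exponent_injective]
  refine Set.ncard_le_ncard fun a ha => ?_
  obtain ⟨haΔ, M, hMK, hMa⟩ := Finset.mem_filter.1 ha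
  obtain ⟨N', rfl⟩ := mem_range_exponent.2 haΔ
  obtain ⟨N, ⟨f, hf, hN⟩, rfl⟩ := hK hMK
  refine ⟨N', ⟨_, ?_, hN.mul_monomialWord (a := N'.exponent - N.exponent) ?_⟩, rfl⟩
  · refine mem_vanishingOn.2 fun x hx => ?_
    rw [Pi.mul_apply, mem_vanishingOn.1 (hD hf) x hx, zero_mul]
  · exact (add_tsub_cancel_of_le hMa).symm

theorem cartesianEval_monomial (a : Fin m → ℕ) :
    cartesianEval S (∏ t, (MvPolynomial.X t : MvPolynomial (Fin m) F) ^ a t) =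
      monomialWord S a := by
  ext x
  simp [cartesianEval, monomialWord, productWord]

section Code

variable {L : Finset (Fin m → ℕ)} (hL : L ⊆ monomialDelta fun t => (S t).card)

include hL

theorem mem_monomialCartesianCode_iff {f : CartesianPoint S → F} :
    f ∈ monomialCartesianCode S L ↔ ∀ n, (gridBasis S).repr f n ≠ 0 → n.exponent ∈ L := by
  have himage : monomialWord S '' L = gridBasis S '' (exponent ⁻¹' L) := by
    have hrange : (L : Set (Fin m → ℕ)) ⊆ Set.range exponent :=
      fun a ha => mem_range_exponent.2 (hL ha)
    rw [← Set.image_preimage_eq_of_subset hrange, Set.image_image,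
      Set.preimage_image_eq _ exponent_injective]
    simp only [gridBasis_apply]
  rw [monomialCartesianCode, Submodule.map_span, Set.image_image]
  simp only [cartesianEval_monomial]
  rw [himage, Module.Basis.mem_span_image]
  simp [Set.subset_def]

theorem leadSet_monomialCartesianCode :
    leadSet (gridBasis S) (monomialCartesianCode S L) = exponent ⁻¹' L := by
  ext N
  constructor
  · rintro ⟨f, hf, hN⟩
    exact (mem_monomialCartesianCode_iff hL).1 hf N (isLead_iff.1 hN).1
  · intro hN
    refine ⟨gridBasis S N, (mem_monomialCartesianCode_iff hL).2 fun n hn => ?_, isLead_self _ N⟩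
    rw [Module.Basis.repr_self, Finsupp.single_apply_ne_zero] at hn
    exact hn.1 ▸ hN

theorem finrank_monomialCartesianCode :
    Module.finrank F (monomialCartesianCode S L) = L.card := by
  rw [← ncard_leadSet (gridBasis S), leadSet_monomialCartesianCode hL,
    ncard_preimage_exponent hL]

theorem exists_shadowSize_le_supportSize {D : Submodule F (CartesianPoint S → F)}
    (hD : D ≤ monomialCartesianCode S L) :
    ∃ K ⊆ L, K.card = Module.finrank F D ∧
      shadowSize (fun t => (S t).card) K ≤ supportSize D := by
  classical
  let K := (leadSet (gridBasis S) D).toFinset.image exponent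
  have hK : (K : Set (Fin m → ℕ)) = exponent '' leadSet (gridBasis S) D := by simp [K]
  refine ⟨K, ?_, ?_, shadowSize_le_supportSize hK.subset⟩
  · rw [← Finset.coe_subset, hK, Set.image_subset_iff, ← leadSet_monomialCartesianCode hL]
    exact fun N ⟨f, hf, hN⟩ => ⟨f, hD hf, hN⟩
  · rw [← Set.ncard_coe_finset, hK, Set.ncard_image_of_injective _ exponent_injective,
      ncard_leadSet]

end Code

theorem exists_isLead_mem_vanishingOn_compl_pi {T : (t : Fin m) → Set (S t)} {N : GridIndex S}
    (hN : ∀ t, (S t).card ≤ (T t).ncard + N.exponent t) :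
    ∃ f ∈ vanishingOn F (Set.univ.pi T)ᶜ, IsLead (gridBasis S) f N ∧
      ∀ n, (gridBasis S).repr f n ≠ 0 → n.exponent ≤ N.exponent := by
  classical
  let Q (t : Fin m) : F[X] := Lagrange.nodal (T t)ᶜ.toFinset Subtype.val
  let P (t : Fin m) : F[X] := Q t * X ^ (N.exponent t - (T t)ᶜ.ncard)
  have hQ (t : Fin m) : (Q t).Monic := Lagrange.nodal_monic
  have hP (t : Fin m) : (P t).natDegree = N.exponent t := by
    have hcompl := Set.ncard_add_ncard_compl (T t)
    rw [Nat.card_eq_finsetCard] at hcompl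
    rw [(hQ t).natDegree_mul (monic_X_pow _), Lagrange.natDegree_nodal, natDegree_X_pow,
      ← Set.ncard_eq_toFinset_card']
    have := hN t
    omega
  refine ⟨productWord S P, mem_vanishingOn.2 fun x hx => ?_,
    isLead_productWord S (fun t => (hQ t).mul (monic_X_pow _)) fun t => (hP t).symm,
    fun n hn t => (exponent_le_natDegree_of_gridBasis_repr_ne_zero S hn t).trans_eq (hP t)⟩
  obtain ⟨t, ht⟩ : ∃ t, x t ∉ T t := by simpa using hx
  refine Finset.prod_eq_zero (Finset.mem_univ t) ?_
  rw [eval_mul, Lagrange.eval_nodal_at_node (v := Subtype.val) (by simpa using ht), zero_mul]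

variable {v j : Fin m → ℕ} (hj : ∀ t, j t < (S t).card)

include hj

theorem exists_isRelativeSubcode_of_subset_considerateBox {T : (t : Fin m) → Set (S t)}
    {R : Finset (Fin m → ℕ)} (hR : R ⊆ considerateBox v j)
    (hT : ∀ a ∈ R, ∀ t, (S t).card ≤ (T t).ncard + a t) :
    ∃ D, IsRelativeSubcode (monomialCartesianCode S (considerateL1 j))
      (monomialCartesianCode S (considerateL2 v j)) R.card D ∧
        D ≤ vanishingOn F (Set.univ.pi T)ᶜ := by
  have hL₁ := considerateL1_subset_monomialDelta hj
  have hL₂ : considerateL2 v j ⊆ _ := Finset.sdiff_subset.trans hL₁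
  choose g hgT hlead hg using fun N : (exponent ⁻¹' R : Set (GridIndex S)) =>
    exists_isLead_mem_vanishingOn_compl_pi (hT _ N.2)
  have hlead_span : leadSet (gridBasis S) (Submodule.span F (Set.range g)) = exponent ⁻¹' R := by
    rw [leadSet_span_range Subtype.val_injective hlead, Subtype.range_coe]
  have hRL₁ : R ⊆ considerateL1 j := hR.trans
    (Fintype.piFinset_subset _ _ fun t => Finset.Icc_subset_Icc_left (Nat.zero_le _))
  refine ⟨Submodule.span F (Set.range g),
    ⟨?_, inf_eq_bot_of_disjoint_leadSet (b := gridBasis S) ?_, ?_⟩, ?_⟩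
  · refine Submodule.span_le.2 (Set.range_subset_iff.2 fun N => ?_)
    refine (mem_monomialCartesianCode_iff hL₁).2 fun n hn => Fintype.mem_piFinset.2 fun t => ?_
    have hNt := Finset.mem_Icc.1 (Fintype.mem_piFinset.1 (hRL₁ N.2) t)
    exact Finset.mem_Icc.2 ⟨Nat.zero_le _, (hg N n hn t).trans hNt.2⟩
  · rw [hlead_span, leadSet_monomialCartesianCode hL₂]
    exact Set.disjoint_left.2 fun N hN hN₂ => (Finset.mem_sdiff.1 hN₂).2 (hR hN)
  · rw [← ncard_leadSet (gridBasis S), hlead_span, ncard_preimage_exponent (hRL₁.trans hL₁)]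
  · exact Submodule.span_le.2 (Set.range_subset_iff.2 hgT)

theorem exists_isRelativeSubcode_le_vanishingOn_compl_pi {T : (t : Fin m) → Set (S t)}
    {p : Fin m → ℕ} (hp : ∀ t, v t + p t ≤ j t + 1)
    (hT : ∀ t, (T t).ncard + (j t + 1) = (S t).card + p t) :
    ∃ D, IsRelativeSubcode (monomialCartesianCode S (considerateL1 j))
      (monomialCartesianCode S (considerateL2 v j)) (∏ t, p t) D ∧
        D ≤ vanishingOn F (Set.univ.pi T)ᶜ := by
  let R := Fintype.piFinset fun t => Finset.Ico (j t + 1 - p t) (j t + 1)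
  have hcard : R.card = ∏ t, p t := by
    rw [Fintype.card_piFinset]
    refine Finset.prod_congr rfl fun t _ => ?_
    rw [Nat.card_Ico]
    have := hp t
    omega
  rw [← hcard]
  refine exists_isRelativeSubcode_of_subset_considerateBox hj ?_ fun a ha t => ?_
  · refine Fintype.piFinset_subset _ _ fun t a ha => ?_
    have := hp t
    rw [Finset.mem_Ico] at ha
    rw [Finset.mem_Icc]
    omega
  · have ha := Finset.mem_Ico.1 (Fintype.mem_piFinset.1 ha t)
    have := hT t
    omega

end Grid

section Footprint

theorem exists_card_add_card_piFinset_Ico_le {s j : Fin 2 → ℕ} (hj : ∀ t, j t < s t)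
    {K : Finset (Fin 2 → ℕ)} (hK : K ⊆ considerateL1 j) (hne : K.Nonempty) :
    ∃ a : Fin 2 → ℕ, (∀ t, a t ≤ j t) ∧
      K ⊆ Fintype.piFinset (fun t => Finset.Ico (a t) (j t + 1)) ∧
      K.card + (Fintype.piFinset fun t => Finset.Ico (a t) (s t)).card ≤
        shadowSize s K + (Fintype.piFinset fun t => Finset.Ico (a t) (j t + 1)).card := by
  classical
  choose A hAK hA using fun t : Fin 2 => K.exists_min_image (fun M => M t) hne
  have hKj {M : Fin 2 → ℕ} (hM : M ∈ K) (t : Fin 2) : M t ≤ j t :=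
    (Finset.mem_Icc.1 (Fintype.mem_piFinset.1 (hK hM) t)).2
  let R := Fintype.piFinset fun t => Finset.Ico (A t t) (s t)
  let Q := Fintype.piFinset fun t => Finset.Ico (A t t) (j t + 1)
  have hKQ : K ⊆ Q := fun M hM => Fintype.mem_piFinset.2 fun t =>
    Finset.mem_Ico.2 ⟨hA t M hM, Nat.lt_succ_of_le (hKj hM t)⟩
  have hQR : Q ⊆ R := Fintype.piFinset_subset _ _ fun t => Finset.Ico_subset_Ico_right (hj t)
  refine ⟨fun t => A t t, fun t => hKj (hAK t) t, hKQ, ?_⟩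
  change K.card + R.card ≤ shadowSize s K + Q.card
  have hshadow : K ∪ R \ Q ⊆ (monomialDelta s).filter fun N => ∃ M ∈ K, ∀ t, M t ≤ N t := by
    intro N hN
    have hNR : N ∈ R := (Finset.union_subset (hKQ.trans hQR) Finset.sdiff_subset) hN
    simp only [R, Q, Finset.mem_union, Finset.mem_sdiff, Finset.mem_filter, monomialDelta,
      Fintype.mem_piFinset, Finset.mem_Ico, Finset.mem_range, Fin.forall_fin_two] at hN hNR ⊢
    refine ⟨⟨hNR.1.2, hNR.2.2⟩, ?_⟩
    rcases hN with hNK | ⟨-, hNQ⟩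
    · exact ⟨N, hNK, le_rfl, le_rfl⟩
    · rcases lt_or_ge (j 0) (N 0) with hN0 | hN0
      · exact ⟨A 1, hAK 1, (hKj (hAK 1) 0).trans hN0.le, hNR.2.1⟩
      · exact ⟨A 0, hAK 0, hNR.1.1, (hKj (hAK 0) 1).trans (by omega)⟩
  have hcard := Finset.card_le_card hshadow
  rw [Finset.card_union_of_disjoint (Finset.disjoint_sdiff.mono_left hKQ)] at hcard
  rw [← Finset.card_sdiff_add_card_eq_card hQR, shadowSize]
  omega

theorem exists_card_le_mul_and_add_card_le_shadowSize {s j d : Fin 2 → ℕ}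
    (hd : ∀ t, s t = j t + 1 + d t) {K : Finset (Fin 2 → ℕ)} (hK : K ⊆ considerateL1 j)
    (hne : K.Nonempty) :
    ∃ p q, K.card ≤ p * q ∧ d 0 * d 1 + d 0 * q + d 1 * p + K.card ≤ shadowSize s K := by
  have hj (t : Fin 2) : j t < s t := by have := hd t; omega
  obtain ⟨a, haj, hKQ, hcard⟩ := exists_card_add_card_piFinset_Ico_le hj hK hne
  obtain ⟨p, hp⟩ : ∃ p : Fin 2 → ℕ, ∀ t, j t + 1 = a t + p t :=
    Classical.axiomOfChoice fun t => Nat.exists_eq_add_of_le ((haj t).trans (Nat.le_succ _))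
  have hKp := Finset.card_le_card hKQ
  simp only [Fintype.card_piFinset, Nat.card_Ico, Fin.prod_univ_two, hd, hp, add_assoc,
    Nat.add_sub_cancel_left] at hcard hKp
  exact ⟨p 0, p 1, hKp, by linarith⟩

end Footprint

section QuarterSquare

/-- `⌊n² / 4⌋`, the largest area of a rectangle with integer sides and half-perimeter `n`. -/
def quarterSquare (n : ℕ) : ℕ := n ^ 2 / 4

theorem quarterSquare_two_mul (z : ℕ) : quarterSquare (2 * z) = z ^ 2 := by
  rw [quarterSquare, mul_pow]
  exact Nat.mul_div_cancel_left _ (by norm_num)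

theorem quarterSquare_two_mul_add_one (z : ℕ) : quarterSquare (2 * z + 1) = (z + 1) * z := by
  rw [quarterSquare, show (2 * z + 1) ^ 2 = 4 * ((z + 1) * z) + 1 by ring]
  omega

theorem quarterSquare_add_pred (z : ℕ) : quarterSquare (z + (z - 1)) = z * (z - 1) := by
  rcases z with _ | z
  · rfl
  · rw [Nat.add_sub_cancel, ← quarterSquare_two_mul_add_one]
    congr 1
    ring

theorem quarterSquare_succ (n : ℕ) : quarterSquare (n + 1) = quarterSquare n + (n + 1) / 2 := by
  rcases Nat.even_or_odd' n with ⟨z, rfl | rfl⟩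
  · rw [quarterSquare_two_mul, quarterSquare_two_mul_add_one, show (2 * z + 1) / 2 = z by omega]
    ring
  · rw [quarterSquare_two_mul_add_one, show 2 * z + 1 + 1 = 2 * (z + 1) by ring,
      quarterSquare_two_mul, Nat.mul_div_cancel_left _ two_pos]
    ring

theorem quarterSquare_monotone : Monotone quarterSquare :=
  monotone_nat_of_le_succ fun n => quarterSquare_succ n ▸ Nat.le_add_right _ _

theorem mul_le_quarterSquare_add (p q : ℕ) : p * q ≤ quarterSquare (p + q) := by
  rw [quarterSquare, Nat.le_div_iff_mul_le (by norm_num), mul_comm, ← mul_assoc]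
  exact four_mul_le_sq_add p q

/-- `e` lies `h` below the quarter-square of `n`, and above the one of `n - 1`. -/
def IsQuarterSquareForm (e n h : ℕ) : Prop :=
  e + h = quarterSquare n ∧ h < n / 2

namespace IsQuarterSquareForm

variable {e n h : ℕ}

theorem le_iff (he : IsQuarterSquareForm e n h) {k : ℕ} : n ≤ k ↔ e ≤ quarterSquare k := by
  obtain ⟨heq, hlt⟩ := he
  constructor
  · intro hnk
    have := quarterSquare_monotone hnk
    omega
  · contrapose!
    intro hkn
    obtain ⟨n, rfl⟩ := Nat.exists_eq_add_one_of_ne_zero (Nat.ne_zero_of_lt hkn)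
    have := quarterSquare_monotone (Nat.lt_succ_iff.1 hkn)
    have := quarterSquare_succ n
    omega

theorem pos (he : IsQuarterSquareForm e n h) : 0 < e := by
  by_contra! h0
  have := (he.le_iff (k := 0)).2 (h0.trans (Nat.zero_le _))
  have := he.2
  omega

theorem le_add_of_le_mul (he : IsQuarterSquareForm e n h) {p q : ℕ} (hpq : e ≤ p * q) :
    n ≤ p + q :=
  he.le_iff.2 (hpq.trans (mul_le_quarterSquare_add p q))

theorem unique {n' h' : ℕ} (he : IsQuarterSquareForm e n h) (he' : IsQuarterSquareForm e n' h') :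
    n = n' ∧ h = h' := by
  obtain rfl : n = n' := le_antisymm
    (he.le_iff.2 (he'.1 ▸ Nat.le_add_right e h')) (he'.le_iff.2 (he.1 ▸ Nat.le_add_right e h))
  exact ⟨rfl, Nat.add_left_cancel (he.1.trans he'.1.symm)⟩

end IsQuarterSquareForm

theorem exists_isQuarterSquareForm {e : ℕ} (he : 1 ≤ e) : ∃ n h, IsQuarterSquareForm e n h := by
  have hex : ∃ n, e ≤ quarterSquare n :=
    ⟨e + 1, (mul_one e).symm.trans_le (mul_le_quarterSquare_add e 1)⟩
  classical
  obtain ⟨n, hn⟩ : ∃ n, Nat.find hex = n + 1 := by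
    refine Nat.exists_eq_add_one_of_ne_zero fun h0 => ?_
    have := h0 ▸ Nat.find_spec hex
    exact absurd (he.trans this) (by decide)
  have hle := hn ▸ Nat.find_spec hex
  have hlt := Nat.find_min hex (m := n) (by omega)
  have := quarterSquare_succ n
  exact ⟨n + 1, quarterSquare (n + 1) - e, by omega, by omega⟩

variable {w e z h : ℕ}

theorem isPronicForm_sq_iff :
    IsPronicForm (w ^ 2) e z h ↔ z ≤ w ∧ IsQuarterSquareForm e (z + (z - 1)) h := by
  rw [IsPronicForm, Nat.cast_pow, Real.sqrt_sq w.cast_nonneg, Nat.cast_le]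
  rcases z with _ | z
  · simp [IsQuarterSquareForm]
  · rw [IsQuarterSquareForm, quarterSquare_add_pred]
    zify
    rw [Nat.add_sub_cancel, add_sub_cancel_right, eq_sub_iff_add_eq]
    omega

theorem isSquareForm_sq_iff :
    IsSquareForm (w ^ 2) e z h ↔ z ≤ w ∧ IsQuarterSquareForm e (2 * z) h := by
  rw [IsSquareForm, IsQuarterSquareForm, quarterSquare_two_mul, Nat.cast_pow,
    Real.sqrt_sq w.cast_nonneg, Nat.cast_le, Nat.mul_div_cancel_left _ two_pos]
  zify
  rw [eq_sub_iff_add_eq]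
  omega

theorem existsUnique_isPronicForm_or_isSquareForm (he : 1 ≤ e) (hw : e ≤ w ^ 2) :
    ((∃! p : ℕ × ℕ, IsPronicForm (w ^ 2) e p.1 p.2) ∧ ¬ ∃ z h, IsSquareForm (w ^ 2) e z h) ∨
      ((∃! p : ℕ × ℕ, IsSquareForm (w ^ 2) e p.1 p.2) ∧
        ¬ ∃ z h, IsPronicForm (w ^ 2) e z h) := by
  simp only [isPronicForm_sq_iff, isSquareForm_sq_iff]
  obtain ⟨n, h, hn⟩ := exists_isQuarterSquareForm he
  have hnw : n ≤ 2 * w := hn.le_iff.2 (quarterSquare_two_mul w ▸ hw)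
  have hpos : 2 ≤ n := by have := hn.2; omega
  rcases Nat.even_or_odd' n with ⟨z, rfl | rfl⟩
  · refine Or.inr ⟨⟨(z, h), ⟨by omega, hn⟩, fun p hp => ?_⟩, ?_⟩
    · have := hp.2.unique hn
      exact Prod.ext (by omega) this.2
    · rintro ⟨z', h', -, hz'⟩
      have := hn.unique hz'
      omega
  · have hz : z + 1 + (z + 1 - 1) = 2 * z + 1 := by omega
    refine Or.inl ⟨⟨(z + 1, h), ⟨by omega, by rwa [hz]⟩, fun p hp => ?_⟩, ?_⟩
    · have := hp.2.unique hn
      exact Prod.ext (by dsimp only; omega) this.2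
    · rintro ⟨z', h', -, hz'⟩
      have := hn.unique hz'
      omega

end QuarterSquare

section NearSquare

variable {F : Type*} [Field F] {S : Fin 2 → Finset F} {j v p : Fin 2 → ℕ} {a e h n : ℕ}

theorem sq_add_mul_add_finrank_le_supportSize (hS : ∀ t, (S t).card = j t + 1 + a)
    {D : Submodule F (CartesianPoint S → F)} (hD : D ≤ monomialCartesianCode S (considerateL1 j))
    (hn : IsQuarterSquareForm (Module.finrank F D) n h) :
    a ^ 2 + a * n + Module.finrank F D ≤ supportSize D := by
  have hj (t : Fin 2) : j t < (S t).card := by have := hS t; omega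
  obtain ⟨K, hK, hKcard, hKD⟩ :=
    exists_shadowSize_le_supportSize (considerateL1_subset_monomialDelta hj) hD
  have hne : K.Nonempty := Finset.card_pos.1 (hKcard ▸ hn.pos)
  obtain ⟨p, q, hpq, hshadow⟩ := exists_card_le_mul_and_add_card_le_shadowSize hS hK hne
  calc
    a ^ 2 + a * n + Module.finrank F D
      ≤ a ^ 2 + a * (p + q) + Module.finrank F D := by
        gcongr
        exact hn.le_add_of_le_mul (hKcard ▸ hpq)
    _ = a * a + a * q + a * p + K.card := by rw [hKcard]; ring
    _ ≤ supportSize D := hshadow.trans hKD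

theorem ncard_univ_pi_fin_two {α : Fin 2 → Type*} (T : (t : Fin 2) → Set (α t)) :
    (Set.univ.pi T).ncard = (T 0).ncard * (T 1).ncard := by
  rw [Set.ncard_def, Set.encard_pi_eq_prod_encard, Fin.prod_univ_two, ENat.toNat_mul,
    Set.ncard_def, Set.ncard_def]

variable (hS : ∀ t, (S t).card = j t + 1 + a) (hp : ∀ t, v t + p t ≤ j t + 1)

include hS hp

theorem exists_isRelativeSubcode_le_vanishingOn_compl_pi_diff (he : e + h = p 0 * p 1)
    {T : (t : Fin 2) → Set (S t)} (hT : ∀ t, (T t).ncard = a + p t) {U : Set (CartesianPoint S)}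
    (hU : U.ncard ≤ h) :
    ∃ D, IsRelativeSubcode (monomialCartesianCode S (considerateL1 j))
      (monomialCartesianCode S (considerateL2 v j)) e D ∧
        D ≤ vanishingOn F (Set.univ.pi T \ U)ᶜ := by
  obtain ⟨D, hD, hDT⟩ := exists_isRelativeSubcode_le_vanishingOn_compl_pi (S := S) (T := T)
    (fun t => by have := hS t; omega) hp fun t => by rw [hS, hT]; ring
  rw [Fin.prod_univ_two] at hD
  exact hD.exists_le_vanishingOn_diff hDT hU he

theorem relGenHammingWeight_add_eq_mul (hpn : p 0 * p 1 = quarterSquare (p 0 + p 1))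
    (he : IsQuarterSquareForm e (p 0 + p 1) h) :
    relGenHammingWeight (monomialCartesianCode S (considerateL1 j))
      (monomialCartesianCode S (considerateL2 v j)) e + h = (a + p 0) * (a + p 1) := by
  have hT (t : Fin 2) : ∃ T : Set (S t), T.ncard = a + p t := by
    have hle : a + p t ≤ (Set.univ : Set (S t)).ncard := by
      rw [Set.ncard_univ, Nat.card_eq_fintype_card, Fintype.card_coe, hS]
      linarith [hp t]
    obtain ⟨T, -, hT⟩ := Set.exists_subset_card_eq hle
    exact ⟨T, hT⟩
  choose T hT using hT
  have hpi : (Set.univ.pi T).ncard = (a + p 0) * (a + p 1) := by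
    rw [ncard_univ_pi_fin_two, hT, hT]
  have heh : e + h = p 0 * p 1 := he.1.trans hpn.symm
  obtain ⟨U, hUT, hU⟩ : ∃ U ⊆ Set.univ.pi T, U.ncard = h :=
    Set.exists_subset_card_eq (by rw [hpi]; nlinarith)
  obtain ⟨D, hD, hDU⟩ := exists_isRelativeSubcode_le_vanishingOn_compl_pi_diff hS hp heh hT hU.le
  have hupper : supportSize D ≤ (Set.univ.pi T \ U).ncard := by
    have := Set.ncard_le_ncard (le_vanishingOn_iff.1 hDU)
    rwa [compl_compl] at this
  have hdiff := Set.ncard_sdiff_add_ncard_of_subset hUT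
  have hle := relGenHammingWeight_le_supportSize hD
  obtain ⟨E, ⟨hE, -, hEe⟩, hEw⟩ := exists_supportSize_eq_relGenHammingWeight ⟨D, hD⟩
  have hlower := sq_add_mul_add_finrank_le_supportSize hS hE (hEe.symm ▸ he)
  rw [hEe, hEw] at hlower
  linarith

end NearSquare

namespace CosetScheme

theorem payload_length_eq_card_considerateBox {m : ℕ} {F : Type*} [Field F] {S : Fin m → Finset F}
    {v j : Fin m → ℕ} (hj : ∀ t, j t < (S t).card) {k ℓ : ℕ}
    (scheme : CosetScheme (monomialCartesianCode S (considerateL2 v j))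
      (monomialCartesianCode S (considerateL1 j)) k ℓ) :
    ℓ = (considerateBox v j).card := by
  have hL₁ := considerateL1_subset_monomialDelta hj
  have hbox : considerateBox v j ⊆ considerateL1 j :=
    Fintype.piFinset_subset _ _ fun t => Finset.Icc_subset_Icc_left (Nat.zero_le _)
  have hcode := scheme.finrank_code
  have hsub := scheme.finrank_sub_code
  rw [finrank_monomialCartesianCode hL₁] at hcode
  rw [considerateL2, finrank_monomialCartesianCode (Finset.sdiff_subset.trans hL₁)] at hsub
  have hdiff := Finset.card_sdiff_add_card_eq_card hbox
  omega

variable {F : Type*} [Field F] {S : Fin 2 → Finset F} {s v j k ℓ e h p q : ℕ}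

theorem parameters_of_isQuarterSquareForm (hS : ∀ t, (S t).card = s) (hj : j < s)
    (scheme : CosetScheme (monomialCartesianCode S (considerateL2 (fun _ => v) fun _ => j))
      (monomialCartesianCode S (considerateL1 fun _ => j)) k ℓ) (heℓ : e ≤ ℓ)
    (hp : v + p ≤ j + 1) (hq : v + q ≤ j + 1) (hpq : p * q = quarterSquare (p + q))
    (he : IsQuarterSquareForm e (p + q) h) :
    (relGenHammingWeight (monomialCartesianCode S (considerateL1 fun _ => j))
      (monomialCartesianCode S (considerateL2 (fun _ => v) fun _ => j)) e : ℤ) =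
        (s - j - 1 + p) * (s - j - 1 + q) - h ∧
      (scheme.reconstructionNumber (ℓ - e + 1) : ℤ) =
        s ^ 2 - (s - j - 1 + p) * (s - j - 1 + q) + h + 1 ∧
      ∀ T : (t : Fin 2) → Set (S t),
        ((T 0).ncard : ℤ) = s - j - 1 + p → ((T 1).ncard : ℤ) = s - j - 1 + q →
        ∀ U ⊆ Set.univ.pi T, U.ncard ≤ h →
          scheme.ObtainsAtMost (Set.univ.pi T \ U)ᶜ (ℓ - e) ∧
          (scheme.MaximumNonQualifying (ℓ - e + 1) (Set.univ.pi T \ U)ᶜ ↔ U.ncard = h) := by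
  obtain ⟨a, rfl⟩ := Nat.exists_eq_add_of_le (Nat.succ_le_of_lt hj)
  have ha : ((j + 1 + a : ℕ) : ℤ) - j - 1 = a := by push_cast; ring
  have hbox (t : Fin 2) : v + ![p, q] t ≤ j + 1 := by fin_cases t <;> assumption
  have hM := relGenHammingWeight_add_eq_mul hS hbox hpq he
  simp only [Matrix.cons_val_zero, Matrix.cons_val_one] at hM
  have hr := scheme.reconstructionNumber_add_relGenHammingWeight heℓ
  have hcard : Nat.card (CartesianPoint S) = (j + 1 + a) ^ 2 := by simp [CartesianPoint, hS]
  rw [ha, ← Nat.cast_add a, ← Nat.cast_add a, ← Nat.cast_mul, ← hM, ← Nat.cast_pow, ← hcard]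
  refine ⟨by push_cast; ring, by omega, fun T hT₀ hT₁ U hUT hU => ?_⟩
  have hT : ∀ t, (T t).ncard = a + ![p, q] t :=
    Fin.forall_fin_two.2 ⟨by change _ = a + p; omega, by change _ = a + q; omega⟩
  have hnot : scheme.NonQualifying (ℓ - e + 1) (Set.univ.pi T \ U)ᶜ :=
    (scheme.nonQualifying_iff_exists_isRelativeSubcode heℓ).2
      (exists_isRelativeSubcode_le_vanishingOn_compl_pi_diff hS hbox (he.1.trans hpq.symm) hT hU)
  refine ⟨scheme.obtainsAtMost_iff_nonQualifying.2 hnot,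
    (scheme.maximumNonQualifying_iff_ncard_add_eq heℓ hnot).trans ?_⟩
  have hpi : (Set.univ.pi T).ncard = (a + p) * (a + q) := by
    rw [ncard_univ_pi_fin_two, hT, hT]
    rfl
  have hdiff := Set.ncard_sdiff_add_ncard_of_subset hUT
  have hcompl : (Set.univ.pi T \ U).ncard + (Set.univ.pi T \ U)ᶜ.ncard =
      Nat.card (CartesianPoint S) := Set.ncard_add_ncard_compl _
  omega

end CosetScheme

theorem mainTheorem3_general {F : Type*} [Field F] (S : Fin 2 → Finset F) (s v j k ℓ : ℕ)
    (hS : ∀ t, (S t).card = s) (hv : v ≤ j) (hj : j < s)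
    (C₁ C₂ : Submodule F (CartesianPoint S → F))
    (hC₁ : C₁ = monomialCartesianCode S (considerateL1 fun _ => j))
    (hC₂ : C₂ = monomialCartesianCode S (considerateL2 (fun _ => v) fun _ => j))
    (scheme : CosetScheme C₂ C₁ k ℓ) :
    Nat.card (CartesianPoint S) = s ^ 2 ∧
    (ℓ : ℤ) = (j - v + 1) ^ 2 ∧
    ∀ e : ℕ, 1 ≤ e → e ≤ ℓ →
      (((∃! p : ℕ × ℕ, IsPronicForm ℓ e p.1 p.2) ∧ ¬ ∃ z h, IsSquareForm ℓ e z h) ∨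
        ((∃! p : ℕ × ℕ, IsSquareForm ℓ e p.1 p.2) ∧ ¬ ∃ z h, IsPronicForm ℓ e z h)) ∧
      (∀ z h : ℕ, IsPronicForm ℓ e z h →
        (relGenHammingWeight C₁ C₂ e : ℤ) = (s - j - 1 + z) * (s - j - 2 + z) - h ∧
        (scheme.reconstructionNumber (ℓ - e + 1) : ℤ) =
          s ^ 2 - (s - j - 1 + z) * (s - j - 2 + z) + h + 1 ∧
        ∀ T : (t : Fin 2) → Set (S t),
          (((T 0).ncard : ℤ) = s - j - 1 + z ∧ ((T 1).ncard : ℤ) = s - j - 2 + z ∨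
            ((T 0).ncard : ℤ) = s - j - 2 + z ∧ ((T 1).ncard : ℤ) = s - j - 1 + z) →
          ∀ U ⊆ Set.univ.pi T, U.ncard ≤ h →
            scheme.ObtainsAtMost (Set.univ.pi T \ U)ᶜ (ℓ - e) ∧
            (scheme.MaximumNonQualifying (ℓ - e + 1) (Set.univ.pi T \ U)ᶜ ↔ U.ncard = h)) ∧
      (∀ z h : ℕ, IsSquareForm ℓ e z h →
        (relGenHammingWeight C₁ C₂ e : ℤ) = (s - j - 1 + z) ^ 2 - h ∧
        (scheme.reconstructionNumber (ℓ - e + 1) : ℤ) = s ^ 2 - (s - j - 1 + z) ^ 2 + h + 1 ∧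
        ∀ T : (t : Fin 2) → Set (S t),
          ((T 0).ncard : ℤ) = s - j - 1 + z → ((T 1).ncard : ℤ) = s - j - 1 + z →
          ∀ U ⊆ Set.univ.pi T, U.ncard ≤ h →
            scheme.ObtainsAtMost (Set.univ.pi T \ U)ᶜ (ℓ - e) ∧
            (scheme.MaximumNonQualifying (ℓ - e + 1) (Set.univ.pi T \ U)ᶜ ↔ U.ncard = h)) := by
  obtain ⟨w, hw⟩ := Nat.exists_eq_add_of_le (hv.trans (Nat.le_succ j))
  subst hC₁ hC₂
  obtain rfl : ℓ = w ^ 2 := by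
    rw [scheme.payload_length_eq_card_considerateBox fun t => hj.trans_eq (hS t).symm]
    simp only [considerateBox, Fintype.card_piFinset_const, Nat.card_Icc]
    rw [← Nat.succ_eq_add_one, hw, Nat.add_sub_cancel_left]
  refine ⟨by simp [CartesianPoint, hS], ?_, fun e he heℓ =>
    ⟨existsUnique_isPronicForm_or_isSquareForm he heℓ, fun z h hzh => ?_, fun z h hzh => ?_⟩⟩
  · have hwℤ : (w : ℤ) = j - v + 1 := by omega
    rw [← hwℤ, Nat.cast_pow]
  · obtain ⟨hzw, hform⟩ := isPronicForm_sq_iff.1 hzh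
    have hz := hzh.2.2.1
    have hpq := (quarterSquare_add_pred z).symm
    have hshift : (s : ℤ) - j - 1 + (z - 1 : ℕ) = s - j - 2 + z := by omega
    obtain ⟨hM, hr, hA⟩ := scheme.parameters_of_isQuarterSquareForm hS hj heℓ
      (p := z) (q := z - 1) (by omega) (by omega) hpq hform
    obtain ⟨-, -, hA'⟩ := scheme.parameters_of_isQuarterSquareForm hS hj heℓ
      (p := z - 1) (q := z) (by omega) (by omega) (by rwa [mul_comm, add_comm])
      (by rwa [add_comm])
    rw [hshift] at hM hr hA hA'
    exact ⟨hM, hr, fun T hT => hT.elim (fun h => hA T h.1 h.2) fun h => hA' T h.1 h.2⟩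
  · obtain ⟨hzw, hform⟩ := isSquareForm_sq_iff.1 hzh
    rw [two_mul] at hform
    have hz : z * z = quarterSquare (z + z) := by rw [← two_mul, quarterSquare_two_mul, sq]
    obtain ⟨hM, hr, hA⟩ := scheme.parameters_of_isQuarterSquareForm hS hj heℓ
      (p := z) (q := z) (by omega) (by omega) hz hform
    rw [← sq] at hM hr
    exact ⟨hM, hr, hA⟩

theorem mainTheorem3 {F : Type*} [Field F] [Finite F] (S : Fin 2 → Finset F) (s v j k ℓ : ℕ)
    (hS : ∀ t, (S t).card = s)
    (hcons : IsConsiderate (fun _ : Fin 2 => s) (fun _ => v) (fun _ => j))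
    (C₁ C₂ : Submodule F (CartesianPoint S → F))
    (hC₁ : C₁ = monomialCartesianCode S (considerateL1 fun _ => j))
    (hC₂ : C₂ = monomialCartesianCode S (considerateL2 (fun _ => v) fun _ => j))
    (scheme : CosetScheme C₂ C₁ k ℓ) :
    Nat.card (CartesianPoint S) = s ^ 2 ∧
    (ℓ : ℤ) = (j - v + 1) ^ 2 ∧
    ∀ e : ℕ, 1 ≤ e → e ≤ ℓ →
      (((∃! p : ℕ × ℕ, IsPronicForm ℓ e p.1 p.2) ∧ ¬ ∃ z h, IsSquareForm ℓ e z h) ∨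
        ((∃! p : ℕ × ℕ, IsSquareForm ℓ e p.1 p.2) ∧ ¬ ∃ z h, IsPronicForm ℓ e z h)) ∧
      (∀ z h : ℕ, IsPronicForm ℓ e z h →
        (relGenHammingWeight C₁ C₂ e : ℤ) = (s - j - 1 + z) * (s - j - 2 + z) - h ∧
        (scheme.reconstructionNumber (ℓ - e + 1) : ℤ) =
          s ^ 2 - (s - j - 1 + z) * (s - j - 2 + z) + h + 1 ∧
        ∀ T : (t : Fin 2) → Set (S t),
          (((T 0).ncard : ℤ) = s - j - 1 + z ∧ ((T 1).ncard : ℤ) = s - j - 2 + z ∨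
            ((T 0).ncard : ℤ) = s - j - 2 + z ∧ ((T 1).ncard : ℤ) = s - j - 1 + z) →
          ∀ U ⊆ Set.univ.pi T, U.ncard ≤ h →
            scheme.ObtainsAtMost (Set.univ.pi T \ U)ᶜ (ℓ - e) ∧
            (scheme.MaximumNonQualifying (ℓ - e + 1) (Set.univ.pi T \ U)ᶜ ↔ U.ncard = h)) ∧
      (∀ z h : ℕ, IsSquareForm ℓ e z h →
        (relGenHammingWeight C₁ C₂ e : ℤ) = (s - j - 1 + z) ^ 2 - h ∧
        (scheme.reconstructionNumber (ℓ - e + 1) : ℤ) = s ^ 2 - (s - j - 1 + z) ^ 2 + h + 1 ∧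
        ∀ T : (t : Fin 2) → Set (S t),
          ((T 0).ncard : ℤ) = s - j - 1 + z → ((T 1).ncard : ℤ) = s - j - 1 + z →
          ∀ U ⊆ Set.univ.pi T, U.ncard ≤ h →
            scheme.ObtainsAtMost (Set.univ.pi T \ U)ᶜ (ℓ - e) ∧
            (scheme.MaximumNonQualifying (ℓ - e + 1) (Set.univ.pi T \ U)ᶜ ↔ U.ncard = h)) :=
  mainTheorem3_general S s v j k ℓ hS (hcons.1 0).1.le (hcons.1 0).2 C₁ C₂ hC₁ hC₂ scheme
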